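/- Let $\mathbb D\subset\mathbb C$ be the open unit disc and, for $n\ge 1$, let $\sigma=(\sigma_1,\dots,\sigma_n):\mathbb C^n\to\mathbb C^n$, where $$\sigma_k(z_1,\dots,z_n)=\sum_{1\le j_1<\dots<j_k\le n}z_{j_1}\cdots z_{j_k},\qquad 1\le k\le n.$$ The symmetrized polydisc is $\mathbb G_n=\sigma(\mathbb D^n)\subset\mathbb C^n$. Let $\mathcal E$ be the class of all domains $D\subset\mathbb C^n$ that can be exhausted by domains biholomorphic to convex domains, that is, such that for every compact set $K\subset D$ there is a domain $D'$ with $K\subset D'\subset D$ that is biholomorphic to a convex domain in $\mathbb C^n$. Then $\mathbb G_n\notin\mathcal E$ for every $n\ge 3$. -/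

import Mathlib

/-- A domain in `ℂⁿ`: a nonempty connected open set. -/
def IsDomainIn {n : ℕ} (D : Set (Fin n → ℂ)) : Prop :=
  IsOpen D ∧ IsConnected D

/-- Two subsets `D`, `G` of `ℂⁿ` (open, in all uses) are biholomorphic: there is a holomorphic
bijection `f : D → G` whose inverse `g : G → D` is holomorphic. -/
def Biholomorphic {n : ℕ} (D G : Set (Fin n → ℂ)) : Prop :=
  ∃ f g : (Fin n → ℂ) → (Fin n → ℂ),
    DifferentiableOn ℂ f D ∧ DifferentiableOn ℂ g G ∧
      Set.MapsTo f D G ∧ Set.MapsTo g G D ∧ Set.InvOn g f D G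

/-- The class `𝓔` of the domains `D` in `ℂⁿ` that can be exhausted by domains biholomorphic to
convex domains: every compact subset of `D` lies in a subdomain `D'` of `D` that is biholomorphic
to a convex domain `G`. A set `D` with this property is automatically nonempty, open and
connected, hence a domain. -/
def classE (n : ℕ) : Set (Set (Fin n → ℂ)) :=
  {D | ∀ K : Set (Fin n → ℂ), IsCompact K → K ⊆ D →
    ∃ D' G : Set (Fin n → ℂ), K ⊆ D' ∧ D' ⊆ D ∧ IsDomainIn D' ∧
      IsDomainIn G ∧ Convex ℝ G ∧ Biholomorphic D' G}

/-- The symmetrization map `σ = (σ₁, …, σₙ) : ℂⁿ → ℂⁿ`, where `σₖ` is the `k`-th elementary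
symmetric function of the coordinates; the index `k : Fin n` starts at `0`. -/
noncomputable def symmetrization (n : ℕ) (z : Fin n → ℂ) : Fin n → ℂ :=
  fun k => ((Finset.univ : Finset (Fin n)).val.map z).esymm ((k : ℕ) + 1)

/-- The symmetrized polydisc `𝔾ₙ = σ(𝔻ⁿ)`. -/
noncomputable def symmetrizedPolydisc (n : ℕ) : Set (Fin n → ℂ) :=
  symmetrization n '' {z | ∀ j, ‖z j‖ < 1}

/-! Points of `𝔾ₙ` are monic polynomials with all zeros in the open disc, and `weightedDilation ζ`
multiplies every zero by `ζ`. If `𝔾ₙ` were in `𝓔`, midpoints could be formed in a convex model of a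
subdomain containing two discs `ζ ↦ ζ·a`, `ζ ↦ ζ·b` with `|ζ| ≤ r < 1`. For `a`, `b` supported in
weights at least `d`, the transported midpoint differs from `ζ·m`, `m = (a + b)/2`, by
`O(|ζ|^(2d))`. Since `2d > n`, undoing the dilation leaves a holomorphic disc through `m` whose
boundary points have zeros of modulus at most `1/r`. The maximum principle passes this bound to `m`,
and `r` may be as close to `1` as desired (`norm_le_one_of_monicEval_midpoint_eq_zero`).

This midpoint property fails for trinomials with `d = n - 1`. Average `tⁿ - t/2 - 1/2` with a
rotation, by angle `α`, of `tⁿ + (c - 1)t - c`, `c = 1/2 + εi`. If the average `P` had its zeros in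
the closed disc, `Re (P'(1) * conj P(1))` would be nonnegative (`re_deriv_mul_conj_nonneg`); it
vanishes at `α = 0`, but its derivative there is not zero. -/

section

open Polynomial

/-! ### Points of `ℂⁿ` as monic polynomials -/

/-- The value at `t` of the monic polynomial of degree `n` whose coefficients below the leading
one are the entries of `w`; at `w = σ(z)` it is `∏ⱼ (t + zⱼ)`. -/
noncomputable def monicEval {n : ℕ} (w : Fin n → ℂ) (t : ℂ) : ℂ :=
  t ^ n + ∑ k : Fin n, w k * t ^ (n - 1 - (k : ℕ))

/-- The weighted dilation `w ↦ (ζ w₁, ζ² w₂, …, ζⁿ wₙ)`. -/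
def weightedDilation {n : ℕ} (ζ : ℂ) (w : Fin n → ℂ) : Fin n → ℂ :=
  fun k => ζ ^ ((k : ℕ) + 1) * w k

lemma monicEval_weightedDilation {n : ℕ} (ζ : ℂ) (w : Fin n → ℂ) (t : ℂ) :
    monicEval (weightedDilation ζ w) (ζ * t) = ζ ^ n * monicEval w t := by
  unfold monicEval weightedDilation
  rw [mul_add, Finset.mul_sum, mul_pow]
  congr 1
  refine Finset.sum_congr rfl fun k _ => ?_
  have : ζ ^ n = ζ ^ ((k : ℕ) + 1) * ζ ^ (n - 1 - (k : ℕ)) := by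
    rw [← pow_add]; congr 1; omega
  rw [this, mul_pow]; ring

lemma continuous_monicEval {n : ℕ} :
    Continuous fun p : (Fin n → ℂ) × ℂ => monicEval p.1 p.2 := by
  unfold monicEval
  fun_prop

lemma monicEval_symmetrization {n : ℕ} (z : Fin n → ℂ) (t : ℂ) :
    monicEval (symmetrization n z) t = ∏ j, (t + z j) := by
  have h := congrArg (Polynomial.eval t)
    (Multiset.prod_X_add_C_eq_sum_esymm ((Finset.univ : Finset (Fin n)).val.map z))
  rw [Finset.sum_range_succ'] at h
  simp only [Multiset.map_map, Multiset.card_map, Finset.card_val, Finset.card_univ,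
    Fintype.card_fin, Polynomial.eval_add, Polynomial.eval_finsetSum] at h
  rw [← Fin.sum_univ_eq_sum_range (fun k => Polynomial.eval t
    (C (Multiset.esymm (Multiset.map z Finset.univ.val) (k + 1)) * X ^ (n - (k + 1)))) n] at h
  have h2 : Polynomial.eval t (Multiset.map ((fun r ↦ X + C r) ∘ z) Finset.univ.val).prod
      = ∏ j, (t + z j) := by
    rw [← Finset.prod_eq_multiset_prod, Polynomial.eval_prod]
    simp
  rw [h2] at h
  rw [h, monicEval, add_comm]
  congr 1
  · refine Finset.sum_congr rfl fun k _ => ?_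
    simp [symmetrization, Nat.sub_sub, Nat.add_comm]
  · simp [Multiset.esymm]

/-- The fundamental theorem of algebra; the `zⱼ` are the negatives of the roots. -/
lemma exists_eq_symmetrization {n : ℕ} (w : Fin n → ℂ) : ∃ z, w = symmetrization n z := by
  set q : ℂ[X] := ∑ k : Fin n, C (w k) * X ^ (n - 1 - (k : ℕ)) with hq
  have hqdeg : q.degree < n := by
    rw [hq, ← Polynomial.mem_degreeLT]
    refine Submodule.sum_mem _ fun k _ => Polynomial.mem_degreeLT.2 ?_
    refine lt_of_le_of_lt (Polynomial.degree_C_mul_X_pow_le _ _) ?_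
    have := k.2
    exact_mod_cast (by omega : n - 1 - (k : ℕ) < n)
  set p : ℂ[X] := X ^ n + q with hp
  have hmonic : p.Monic := Polynomial.monic_X_pow_add hqdeg
  have hdeg : p.natDegree = n := by
    apply Polynomial.natDegree_eq_of_degree_eq_some
    rw [hp, Polynomial.degree_add_eq_left_of_degree_lt] <;> simp [hqdeg]
  have hsplit : p.Splits := IsAlgClosed.splits p
  have hcard : Multiset.card p.roots = n := by
    rw [Polynomial.splits_iff_card_roots.1 hsplit, hdeg]
  obtain ⟨l, hl⟩ := Quot.exists_rep p.roots
  have hlen : l.length = n := by rw [← hcard, ← hl]; rfl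
  subst hlen
  refine ⟨fun j => -l.get j, ?_⟩
  funext k
  have hk : l.length - 1 - (k : ℕ) ≤ p.natDegree := by omega
  have hc := Polynomial.coeff_eq_esymm_roots_of_splits hsplit hk
  have hc' : p.coeff (l.length - 1 - (k : ℕ)) = w k := by
    rw [hp, hq, Polynomial.coeff_add, Polynomial.finsetSum_coeff, Polynomial.coeff_X_pow,
      if_neg (by have := k.2; omega), zero_add, Finset.sum_eq_single k]
    · simp
    · intro b _ hb
      rw [Polynomial.coeff_C_mul, Polynomial.coeff_X_pow, if_neg, mul_zero]
      intro h; apply hb; ext; have := k.2; have := b.2; omega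
    · simp
  have hd : p.natDegree - (l.length - 1 - (k : ℕ)) = k + 1 := by have := k.2; omega
  rw [← hc', hc, hmonic.leadingCoeff, one_mul, hd, symmetrization, ← Multiset.esymm_neg, ← hl]
  congr 1
  simp

lemma mem_symmetrizedPolydisc_iff {n : ℕ} (w : Fin n → ℂ) :
    w ∈ symmetrizedPolydisc n ↔ ∀ t, monicEval w t = 0 → ‖t‖ < 1 := by
  constructor
  · rintro ⟨z, hz, rfl⟩ t ht
    rw [monicEval_symmetrization, Finset.prod_eq_zero_iff] at ht
    obtain ⟨j, -, hj⟩ := ht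
    rw [eq_neg_of_add_eq_zero_left hj, norm_neg]
    exact hz j
  · intro h
    obtain ⟨z, rfl⟩ := exists_eq_symmetrization w
    refine ⟨z, fun j => ?_, rfl⟩
    rw [← norm_neg]
    apply h
    rw [monicEval_symmetrization, Finset.prod_eq_zero_iff]
    exact ⟨j, Finset.mem_univ _, by simp⟩

lemma weightedDilation_mem_symmetrizedPolydisc {n : ℕ} {w : Fin n → ℂ}
    (hw : ∀ t, monicEval w t = 0 → ‖t‖ ≤ 1) {ζ : ℂ} (hζ : ‖ζ‖ < 1) :
    weightedDilation ζ w ∈ symmetrizedPolydisc n := by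
  rw [mem_symmetrizedPolydisc_iff]
  intro t ht
  rcases eq_or_ne ζ 0 with rfl | h0
  · have : t ^ n = 0 := by simpa [monicEval, weightedDilation] using ht
    rw [eq_zero_of_pow_eq_zero this]; simp
  · have h := monicEval_weightedDilation ζ w (t / ζ)
    rw [mul_div_cancel₀ _ h0, ht] at h
    have h1 := hw _ ((mul_eq_zero.1 h.symm).resolve_left (pow_ne_zero _ h0))
    rw [norm_div, div_le_one (norm_pos_iff.2 h0)] at h1
    exact h1.trans_lt hζ

/-- Where `P(1) ≠ 0`, `P'(1)/P(1) = ∑ 1/(1 + zⱼ)` and each term has nonnegative real part.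
Multiplying by `|P(1)|²` keeps the statement valid when `P(1) = 0`. -/
lemma re_deriv_mul_conj_nonneg {n : ℕ} {w : Fin n → ℂ}
    (hw : ∀ t, monicEval w t = 0 → ‖t‖ ≤ 1) :
    0 ≤ (deriv (monicEval w) 1 * starRingEnd ℂ (monicEval w 1)).re := by
  obtain ⟨z, rfl⟩ := exists_eq_symmetrization w
  have hz : ∀ j, ‖z j‖ ≤ 1 := by
    intro j
    rw [← norm_neg]
    apply hw
    rw [monicEval_symmetrization, Finset.prod_eq_zero_iff]
    exact ⟨j, Finset.mem_univ _, by simp⟩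
  have hfun : monicEval (symmetrization n z) = fun t => ∏ j, (t + z j) :=
    funext (monicEval_symmetrization z)
  have hd : deriv (fun t => ∏ j, (t + z j)) 1
      = ∑ j, ∏ i ∈ Finset.univ.erase j, (1 + z i) := by
    rw [deriv_fun_finsetProd]
    · simp
    · intro j _; fun_prop
  rw [hfun, hd, Finset.sum_mul, Complex.re_sum]
  refine Finset.sum_nonneg fun j _ => ?_
  beta_reduce
  rw [← Finset.mul_prod_erase _ _ (Finset.mem_univ j), map_mul]
  have : ∀ u v : ℂ, (u * (starRingEnd ℂ v * starRingEnd ℂ u)).re = Complex.normSq u * v.re := by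
    intro u v; simp [Complex.normSq_apply]; ring
  rw [this]
  refine mul_nonneg (Complex.normSq_nonneg _) ?_
  have h1 := Complex.abs_re_le_norm (z j)
  have h2 := neg_abs_le (z j).re
  have h3 := hz j
  simp only [Complex.add_re, Complex.one_re]
  linarith

end

/-! ### Second-order estimates for transported midpoints -/

open Filter Topology Metric Set

section

variable {E F : Type*} [NormedAddCommGroup E] [NormedSpace ℂ E]
  [NormedAddCommGroup F] [NormedSpace ℂ F]

/-- A holomorphic map agrees with its first order Taylor polynomial up to a quadratic error. -/
lemma exists_norm_taylor_le {f : E → F} {U : Set E} (hU : IsOpen U) (h0 : (0 : E) ∈ U)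
    (hf : DifferentiableOn ℂ f U) :
    ∃ C > 0, ∃ R > 0, ball 0 R ⊆ U ∧
      ∀ x ∈ ball (0 : E) R, ‖f x - f 0 - fderiv ℂ f 0 x‖ ≤ C * ‖x‖ ^ 2 := by
  set h : E → F := fun x => f x - f 0 - fderiv ℂ f 0 x with hh
  have hh0 : h 0 = 0 := by simp [hh]
  have hdiff : DifferentiableOn ℂ h U := by
    refine (hf.sub_const _).sub ?_
    exact (fderiv ℂ f 0).differentiable.differentiableOn
  have hcont : ContinuousAt h 0 := (hdiff.continuousOn.continuousAt (hU.mem_nhds h0))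
  have hev : ∀ᶠ x in 𝓝 (0 : E), x ∈ U ∧ h x ∈ closedBall (h 0) 1 :=
    (hU.eventually_mem h0).and (hcont (closedBall_mem_nhds _ one_pos))
  obtain ⟨R, hR, hball⟩ := Metric.eventually_nhds_iff_ball.1 hev
  refine ⟨1 / R ^ 2, by positivity, R, hR, fun x hx => (hball x hx).1, fun x hx => ?_⟩
  have hfd : HasFDerivAt f (fderiv ℂ f 0) 0 := (hf.differentiableAt (hU.mem_nhds h0)).hasFDerivAt
  have ho : (fun x => h x - h 0) =o[𝓝 0] fun w => ‖w - 0‖ ^ 1 := by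
    have := hfd.isLittleO
    simp only [sub_zero, pow_one, hh0]
    exact (this.norm_right.congr (fun x => by simp [hh]) (fun x => by simp))
  -- Schwarz lemma for the remainder, which vanishes to second order and is bounded by `1` on the
  -- ball of radius `R`.
  have := Complex.dist_le_mul_div_pow_of_mapsTo_ball_of_isLittleO (n := 1)
    (hdiff.mono fun x hx => (hball x hx).1) (fun x hx => (hball x hx).2) ho hx
  rw [hh0, dist_zero_right, dist_zero_right] at this
  calc _ ≤ _ := this
    _ = _ := by ring

/-- A holomorphic map is locally Lipschitz. -/
lemma exists_dist_le_of_differentiableOn {g : E → F} {U : Set E} (hU : IsOpen U) {p : E}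
    (hp : p ∈ U) (hg : DifferentiableOn ℂ g U) :
    ∃ C > 0, ∃ R > 0, ∀ u ∈ ball p R, ∀ v ∈ ball p R, dist (g u) (g v) ≤ C * dist u v := by
  have hcont : ContinuousAt g p := hg.continuousOn.continuousAt (hU.mem_nhds hp)
  have hev : ∀ᶠ x in 𝓝 p, x ∈ U ∧ g x ∈ ball (g p) 1 :=
    (hU.eventually_mem hp).and (hcont (ball_mem_nhds _ one_pos))
  obtain ⟨R, hR, hball⟩ := Metric.eventually_nhds_iff_ball.1 hev
  refine ⟨2 / (R / 2), by positivity, R / 4, by positivity, fun u hu v hv => ?_⟩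
  rw [mem_ball] at hu hv
  have hsub : ball v (R / 2) ⊆ ball p R := ball_subset_ball' (by linarith)
  refine Complex.dist_le_div_mul_dist_of_mapsTo_ball (R₁ := R / 2)
    (hg.mono fun x hx => (hball x (hsub hx)).1) (fun x hx => ?_) ?_
  · have h1 := (hball x (hsub hx)).2
    have h2 := (hball v (mem_ball.2 (by linarith))).2
    rw [mem_ball] at h1 h2
    rw [mem_closedBall]
    linarith [dist_triangle_right (g x) (g v) (g p)]
  · rw [mem_ball]
    linarith [dist_triangle_right u v p]

/-- Transporting midpoints by a biholomorphism changes them only to second order. -/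
lemma exists_norm_midpoint_sub_le {f : E → F} {g : F → E} {U : Set E} {V : Set F}
    (hU : IsOpen U) (hV : IsOpen V) (h0 : (0 : E) ∈ U) (hf : DifferentiableOn ℂ f U)
    (hg : DifferentiableOn ℂ g V) (hfV : MapsTo f U V) (hgf : LeftInvOn g f U) :
    ∃ C > 0, ∃ δ > 0, ∀ ε < δ, ∀ x y : E, ‖x‖ ≤ ε → ‖y‖ ≤ ε →
      ‖g ((2⁻¹ : ℝ) • f x + (2⁻¹ : ℝ) • f y) - ((2⁻¹ : ℝ) • x + (2⁻¹ : ℝ) • y)‖ ≤ C * ε ^ 2 := by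
  obtain ⟨C₁, hC₁, R₁, hR₁, hRU, hT⟩ := exists_norm_taylor_le hU h0 hf
  obtain ⟨C₂, hC₂, R₂, hR₂, hL⟩ := exists_dist_le_of_differentiableOn hV (hfV h0) hg
  have hcont : ContinuousAt f 0 := hf.continuousOn.continuousAt (hU.mem_nhds h0)
  obtain ⟨R₃, hR₃, hball⟩ := Metric.eventually_nhds_iff_ball.1
    (hcont (ball_mem_nhds (f 0) hR₂))
  refine ⟨C₂ * (2 * C₁), by positivity, min R₁ R₃, lt_min hR₁ hR₃, fun ε hε x y hx hy => ?_⟩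
  obtain ⟨hε₁, hε₃⟩ := lt_min_iff.1 hε
  set m : E := (2⁻¹ : ℝ) • x + (2⁻¹ : ℝ) • y with hm
  have hmε : ‖m‖ ≤ ε := by
    refine (norm_add_le _ _).trans ?_
    rw [norm_smul, norm_smul]
    norm_num
    linarith
  have mem₁ : ∀ {z : E}, ‖z‖ ≤ ε → z ∈ ball (0 : E) R₁ := fun h => by
    rw [mem_ball_zero_iff]; exact h.trans_lt hε₁
  have mem₃ : ∀ {z : E}, ‖z‖ ≤ ε → f z ∈ ball (f 0) R₂ := fun h =>
    hball _ (by rw [mem_ball_zero_iff]; exact h.trans_lt hε₃)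
  have taylor : ∀ {z : E}, ‖z‖ ≤ ε → ‖f z - f 0 - fderiv ℂ f 0 z‖ ≤ C₁ * ε ^ 2 := fun h =>
    (hT _ (mem₁ h)).trans (by gcongr)
  have hconv : (2⁻¹ : ℝ) • f x + (2⁻¹ : ℝ) • f y ∈ ball (f 0) R₂ :=
    convex_ball (f 0) R₂ (mem₃ hx) (mem₃ hy) (by norm_num) (by norm_num) (by norm_num)
  have key := hL _ hconv _ (mem₃ hmε)
  rw [hgf (hRU (mem₁ hmε)), dist_eq_norm, dist_eq_norm] at key
  refine key.trans ?_
  rw [mul_assoc]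
  gcongr
  have hlin : fderiv ℂ f 0 m = (2⁻¹ : ℝ) • fderiv ℂ f 0 x + (2⁻¹ : ℝ) • fderiv ℂ f 0 y := by
    rw [hm, map_add]
    simp [← Complex.coe_smul]
  have hdecomp : (2⁻¹ : ℝ) • f x + (2⁻¹ : ℝ) • f y - f m
      = (2⁻¹ : ℝ) • (f x - f 0 - fderiv ℂ f 0 x) + (2⁻¹ : ℝ) • (f y - f 0 - fderiv ℂ f 0 y)
        - (f m - f 0 - fderiv ℂ f 0 m) := by
    rw [hlin]; module
  rw [hdecomp]
  refine (norm_sub_le _ _).trans ?_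
  have h1 := taylor hx
  have h2 := taylor hy
  have h3 := taylor hmε
  have h4 := norm_add_le ((2⁻¹ : ℝ) • (f x - f 0 - fderiv ℂ f 0 x))
    ((2⁻¹ : ℝ) • (f y - f 0 - fderiv ℂ f 0 y))
  rw [norm_smul, norm_smul] at h4
  norm_num at h4
  linarith

end

/-! ### Maximum principle for zeros -/

lemma norm_le_of_monicEval_eq_zero {n : ℕ} {w : Fin n → ℂ} {t : ℂ} (h : monicEval w t = 0) :
    ‖t‖ ≤ max 1 (n * ‖w‖) := by
  by_contra! hlt
  obtain ⟨h1, h2⟩ := max_lt_iff.1 hlt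
  rcases Nat.eq_zero_or_pos n with rfl | hn
  · simp [monicEval] at h
  have hb : ‖t‖ ^ n ≤ (n * ‖w‖) * ‖t‖ ^ (n - 1) := by
    rw [← norm_pow, eq_neg_of_add_eq_zero_left h, norm_neg]
    refine (norm_sum_le _ _).trans ?_
    calc ∑ k : Fin n, ‖w k * t ^ (n - 1 - (k : ℕ))‖
        ≤ ∑ _k : Fin n, ‖w‖ * ‖t‖ ^ (n - 1) := by
          refine Finset.sum_le_sum fun k _ => ?_
          rw [norm_mul, norm_pow]
          exact mul_le_mul (norm_le_pi_norm w k) (pow_le_pow_right₀ h1.le (Nat.sub_le _ _))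
            (by positivity) (norm_nonneg _)
      _ = _ := by simp [mul_assoc]
  have : ‖t‖ ^ n = ‖t‖ * ‖t‖ ^ (n - 1) := by
    rw [← pow_succ']; congr 1; omega
  rw [this] at hb
  exact absurd (le_of_mul_le_mul_right hb (by positivity)) (not_le.2 h2)

/-- A maximum principle for the largest modulus of the zeros of a monic polynomial depending
holomorphically on a parameter. -/
lemma norm_le_of_monicEval_eq_zero_of_sphere {n : ℕ} {φ : ℂ → Fin n → ℂ} {r s : ℝ} (hr : 0 < r)
    (hs : 0 < s)
    (hφ : DiffContOnCl ℂ φ (ball 0 r))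
    (hsphere : ∀ ζ ∈ sphere (0 : ℂ) r, ∀ t, monicEval (φ ζ) t = 0 → ‖t‖ ≤ s)
    {ζ t : ℂ} (hζ : ζ ∈ closedBall (0 : ℂ) r) (ht : monicEval (φ ζ) t = 0) : ‖t‖ ≤ s := by
  by_contra! hlt
  have hcont : ContinuousOn φ (closedBall 0 r) := by
    rw [← closure_ball _ hr.ne']; exact hφ.continuousOn
  obtain ⟨B, hB⟩ := (isCompact_closedBall (0 : ℂ) r).exists_bound_of_continuousOn hcont
  have hev : ContinuousOn (fun p : ℂ × ℂ => monicEval (φ p.1) p.2) (closedBall 0 r ×ˢ univ) :=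
    continuous_monicEval.comp_continuousOn
      ((hcont.comp continuousOn_fst fun p hp => hp.1).prodMk continuousOn_snd)
  set M : ℝ := max 1 (n * B)
  set Z : Set (ℂ × ℂ) := (closedBall 0 r ×ˢ closedBall 0 M) ∩
    (fun p : ℂ × ℂ => monicEval (φ p.1) p.2) ⁻¹' {0} with hZ
  have hZc : IsCompact Z := by
    have hK : IsCompact ((closedBall 0 r ×ˢ closedBall 0 M : Set (ℂ × ℂ))) :=
      (isCompact_closedBall _ _).prod (isCompact_closedBall _ _)
    refine hK.of_isClosed_subset ?_ inter_subset_left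
    exact (hev.mono (prod_mono_right (subset_univ _))).preimage_isClosed_of_isClosed
      hK.isClosed isClosed_singleton
  have hmemZ : ∀ ζ ∈ closedBall (0 : ℂ) r, ∀ t, monicEval (φ ζ) t = 0 → (ζ, t) ∈ Z := by
    intro ζ hζ t ht
    refine ⟨⟨hζ, ?_⟩, ht⟩
    rw [mem_closedBall_zero_iff]
    refine (norm_le_of_monicEval_eq_zero ht).trans ?_
    exact max_le_max le_rfl (by gcongr; exact hB ζ hζ)
  -- `t₀` is a largest zero over the whole closed disc of parameters; no zero lies beyond `‖t₀‖`.
  obtain ⟨⟨ζ₀, t₀⟩, hmem₀, hmax⟩ := hZc.exists_isMaxOn ⟨_, hmemZ ζ hζ t ht⟩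
    (f := fun p : ℂ × ℂ => ‖p.2‖) (by fun_prop)
  have hst₀ : s < ‖t₀‖ := hlt.trans_le (hmax (hmemZ ζ hζ t ht))
  have hne : ∀ ζ ∈ closedBall (0 : ℂ) r, ∀ T, ‖t₀‖ < ‖T‖ → monicEval (φ ζ) T ≠ 0 :=
    fun ζ hζ T hT h0 => absurd (hmax (hmemZ ζ hζ T h0)) (not_le.2 hT)
  have hS : IsCompact (sphere (0 : ℂ) r ×ˢ (closedBall (0 : ℂ) (2 * ‖t₀‖) \ ball 0 ‖t₀‖)) :=
    (isCompact_sphere _ _).prod ((isCompact_closedBall _ _).diff isOpen_ball)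
  obtain ⟨p, hp, hpmin⟩ : ∃ p ∈ sphere (0 : ℂ) r ×ˢ (closedBall (0 : ℂ) (2 * ‖t₀‖) \ ball 0 ‖t₀‖),
      IsMinOn (fun p : ℂ × ℂ => ‖monicEval (φ p.1) p.2‖)
        (sphere (0 : ℂ) r ×ˢ (closedBall (0 : ℂ) (2 * ‖t₀‖) \ ball 0 ‖t₀‖)) p := by
    refine hS.exists_isMinOn ⟨((r : ℂ), t₀), ?_, ?_, ?_⟩
      (hev.mono (prod_mono sphere_subset_closedBall (subset_univ _))).norm
    · simp [abs_of_pos hr]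
    · simp; linarith [norm_nonneg t₀]
    · simp
  set d : ℝ := ‖monicEval (φ p.1) p.2‖ with hd
  have hdpos : 0 < d := by
    rw [hd, norm_pos_iff]
    intro h0
    have h1 := hsphere _ hp.1 _ h0
    have h2 := hp.2.2
    rw [mem_ball_zero_iff, not_lt] at h2
    linarith
  -- For `T` just beyond `t₀`, the reciprocal of `monicEval (φ ζ) T` is holomorphic in `ζ`, so its
  -- bound on the circle holds at `ζ₀`. The bound `d` does not depend on `ε`, whereas the value at
  -- `ζ₀` tends to `0` with `ε`.
  have hlow : ∀ ε : ℝ, 0 < ε → ε < 1 → d ≤ ‖monicEval (φ ζ₀) ((1 + ε : ℝ) * t₀)‖ := by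
    intro ε hε hε1
    set T : ℂ := (1 + ε : ℝ) * t₀ with hT
    have hnT : ‖T‖ = (1 + ε) * ‖t₀‖ := by
      rw [hT, norm_mul, Complex.norm_real, Real.norm_of_nonneg (by positivity)]
    have hpos : 0 < ‖t₀‖ := hs.trans hst₀
    have hT1 : ‖t₀‖ < ‖T‖ := by rw [hnT]; nlinarith
    have hT2 : ‖T‖ ≤ 2 * ‖t₀‖ := by rw [hnT]; nlinarith
    have hdc : DiffContOnCl ℂ (fun ζ => monicEval (φ ζ) T) (ball 0 r) := by
      refine ⟨?_, ?_⟩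
      · have := differentiableOn_pi.1 hφ.differentiableOn
        unfold monicEval
        fun_prop
      · exact continuous_monicEval.comp_continuousOn
          (hφ.continuousOn.prodMk continuousOn_const)
    have hinv : DiffContOnCl ℂ (fun ζ => (monicEval (φ ζ) T)⁻¹) (ball 0 r) := by
      refine hdc.inv fun ζ hζ => ?_
      rw [closure_ball _ hr.ne'] at hζ
      exact hne ζ hζ T hT1
    have := Complex.norm_le_of_forall_mem_frontier_norm_le isBounded_ball hinv (C := d⁻¹)
      (fun ζ hζ => ?_) (z := ζ₀) (by rw [closure_ball _ hr.ne']; exact hmem₀.1.1)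
    · rw [norm_inv] at this
      exact (inv_le_inv₀ (norm_pos_iff.2 (hne ζ₀ hmem₀.1.1 T hT1)) hdpos).1 this
    · rw [frontier_ball _ hr.ne'] at hζ
      rw [norm_inv]
      refine inv_anti₀ hdpos (hpmin (a := (ζ, T)) ⟨hζ, ?_, ?_⟩)
      · simpa using hT2
      · simpa using hT1.le
  have hlim : Tendsto (fun ε : ℝ => ‖monicEval (φ ζ₀) ((1 + ε : ℝ) * t₀)‖) (𝓝[>] 0) (𝓝 0) := by
    have hc : Continuous fun ε : ℝ => ‖monicEval (φ ζ₀) ((1 + ε : ℝ) * t₀)‖ :=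
      (continuous_monicEval.comp (by fun_prop :
        Continuous fun ε : ℝ => (φ ζ₀, (((1 + ε : ℝ) : ℂ) * t₀)))).norm
    have h := hc.tendsto 0
    have hz : monicEval (φ ζ₀) t₀ = 0 := hmem₀.2
    simp only [add_zero, Complex.ofReal_one, one_mul, hz, norm_zero] at h
    exact h.mono_left nhdsWithin_le_nhds
  have : d ≤ 0 := by
    refine ge_of_tendsto hlim ?_
    filter_upwards [Ioo_mem_nhdsGT (one_pos : (0 : ℝ) < 1)] with ε hε
    exact hlow ε hε.1 hε.2
  linarith

/-! ### Midpoints in high weights -/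

lemma norm_weightedDilation_le {n : ℕ} {w : Fin n → ℂ} {d : ℕ}
    (hw : ∀ k : Fin n, (k : ℕ) + 1 < d → w k = 0) {ζ : ℂ} (hζ : ‖ζ‖ ≤ 1) :
    ‖weightedDilation ζ w‖ ≤ ‖ζ‖ ^ d * ‖w‖ := by
  rw [pi_norm_le_iff_of_nonneg (by positivity)]
  intro k
  rw [weightedDilation, norm_mul, norm_pow]
  by_cases hk : (k : ℕ) + 1 < d
  · rw [hw k hk, norm_zero, mul_zero]; positivity
  · exact mul_le_mul (pow_le_pow_of_le_one (norm_nonneg _) hζ (not_lt.1 hk)) (norm_le_pi_norm w k)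
      (norm_nonneg _) (by positivity)

lemma differentiable_weightedDilation {n : ℕ} (w : Fin n → ℂ) :
    Differentiable ℂ fun ζ => weightedDilation ζ w := by
  unfold weightedDilation
  fun_prop

/-- If the symmetrized polydisc could be exhausted by domains biholomorphic to convex ones, then
the part of its closure in the span of the coordinates of weight at least `d > n / 2` would be
closed under midpoints. -/
lemma norm_le_one_of_monicEval_midpoint_eq_zero {n d : ℕ} (hd : n < 2 * d)
    (hE : symmetrizedPolydisc n ∈ classE n) {a b : Fin n → ℂ}
    (ha : ∀ k : Fin n, (k : ℕ) + 1 < d → a k = 0) (hb : ∀ k : Fin n, (k : ℕ) + 1 < d → b k = 0)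
    (ha1 : ∀ t, monicEval a t = 0 → ‖t‖ ≤ 1) (hb1 : ∀ t, monicEval b t = 0 → ‖t‖ ≤ 1)
    {t : ℂ} (ht : monicEval ((2⁻¹ : ℝ) • a + (2⁻¹ : ℝ) • b) t = 0) : ‖t‖ ≤ 1 := by
  by_contra! hlt
  obtain ⟨r, hr₁, hr1⟩ := exists_between (inv_lt_one_of_one_lt₀ hlt)
  have hr0 : 0 < r := (inv_pos.2 (one_pos.trans hlt)).trans hr₁
  set m : Fin n → ℂ := (2⁻¹ : ℝ) • a + (2⁻¹ : ℝ) • b with hm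
  have hda := differentiable_weightedDilation a
  have hdb := differentiable_weightedDilation b
  obtain ⟨D', G, hKD, hD'G, ⟨hD'o, -⟩, ⟨hGo, -⟩, hconv, f, g, hf, hg, hfm, hgm, hinv, -⟩ := hE
    ((fun ζ => weightedDilation ζ a) '' closedBall 0 r ∪
      (fun ζ => weightedDilation ζ b) '' closedBall 0 r)
    (((isCompact_closedBall _ _).image hda.continuous).union
      ((isCompact_closedBall _ _).image hdb.continuous))
    (by
      rintro _ (⟨ζ, hζ, rfl⟩ | ⟨ζ, hζ, rfl⟩)
      · exact weightedDilation_mem_symmetrizedPolydisc ha1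
          ((mem_closedBall_zero_iff.1 hζ).trans_lt hr1)
      · exact weightedDilation_mem_symmetrizedPolydisc hb1
          ((mem_closedBall_zero_iff.1 hζ).trans_lt hr1))
  set U : Set ℂ := {ζ | weightedDilation ζ a ∈ D' ∧ weightedDilation ζ b ∈ D'} with hU
  have hUo : IsOpen U := (hD'o.preimage hda.continuous).inter (hD'o.preimage hdb.continuous)
  have hrU : closedBall 0 r ⊆ U := fun ζ hζ =>
    ⟨hKD (Or.inl ⟨ζ, hζ, rfl⟩), hKD (Or.inr ⟨ζ, hζ, rfl⟩)⟩
  have h0U : (0 : ℂ) ∈ U := hrU (mem_closedBall_self hr0.le)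
  have hzero : ∀ w : Fin n → ℂ, weightedDilation 0 w = 0 := fun w => by
    funext k; simp [weightedDilation]
  have h0D : (0 : Fin n → ℂ) ∈ D' := by have := h0U.1; rwa [hzero] at this
  set ψ : ℂ → Fin n → ℂ := fun ζ =>
    g ((2⁻¹ : ℝ) • f (weightedDilation ζ a) + (2⁻¹ : ℝ) • f (weightedDilation ζ b)) with hψ
  have hmid : ∀ ζ ∈ U,
      (2⁻¹ : ℝ) • f (weightedDilation ζ a) + (2⁻¹ : ℝ) • f (weightedDilation ζ b) ∈ G :=
    fun ζ hζ => hconv (hfm hζ.1) (hfm hζ.2) (by norm_num) (by norm_num) (by norm_num)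
  have hψd : DifferentiableOn ℂ ψ U := by
    refine hg.comp ?_ hmid
    exact ((hf.comp hda.differentiableOn fun ζ hζ => hζ.1).const_smul (2⁻¹ : ℝ)).add
      ((hf.comp hdb.differentiableOn fun ζ hζ => hζ.2).const_smul (2⁻¹ : ℝ))
  have hψG : ∀ ζ ∈ U, ψ ζ ∈ symmetrizedPolydisc n := fun ζ hζ => hD'G (hgm (hmid ζ hζ))
  -- The inverse dilation applied to `ψ ζ`; the value `m` at `0` removes the singularity.
  set φ : ℂ → Fin n → ℂ := fun ζ => if ζ = 0 then m else fun k => ψ ζ k / ζ ^ ((k : ℕ) + 1) with hφ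
  have hφψ : ∀ ζ ≠ 0, weightedDilation ζ (φ ζ) = ψ ζ := by
    intro ζ hζ
    funext k
    simp only [weightedDilation, hφ, if_neg hζ]
    field_simp
  have hφ0 : φ 0 = m := by simp [hφ]
  obtain ⟨C, hC, δ, hδ, hest⟩ := exists_norm_midpoint_sub_le hD'o hGo h0D hf hg hfm hinv
  set A : ℝ := ‖a‖ + ‖b‖ with hA
  have hA0 : 0 ≤ A := by positivity
  rcases Nat.eq_zero_or_pos d with rfl | hdpos
  · simp at hd
  have hsmall : ∀ᶠ ζ : ℂ in 𝓝 0, ‖ζ‖ ^ d * A < δ ∧ ‖ζ‖ < 1 := by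
    have h1 : Tendsto (fun ζ : ℂ => ‖ζ‖ ^ d * A) (𝓝 0) (𝓝 0) := by
      have : Continuous fun ζ : ℂ => ‖ζ‖ ^ d * A := by fun_prop
      simpa [hdpos.ne'] using this.tendsto 0
    have h2 : Tendsto (fun ζ : ℂ => ‖ζ‖) (𝓝 0) (𝓝 0) := by
      simpa using (continuous_norm (E := ℂ)).tendsto 0
    exact (h1.eventually_lt_const hδ).and (h2.eventually_lt_const one_pos)
  have hφest : ∀ᶠ ζ : ℂ in 𝓝 0, ‖φ ζ - m‖ ≤ C * A ^ 2 * ‖ζ‖ := by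
    filter_upwards [hsmall] with ζ ⟨hζδ, hζ1⟩
    rcases eq_or_ne ζ 0 with rfl | hζ0
    · simp [hφ0]
    have hpos : 0 < ‖ζ‖ := norm_pos_iff.2 hζ0
    have h := hest _ hζδ (weightedDilation ζ a) (weightedDilation ζ b)
      ((norm_weightedDilation_le ha hζ1.le).trans (by gcongr; linarith [norm_nonneg b]))
      ((norm_weightedDilation_le hb hζ1.le).trans (by gcongr; linarith [norm_nonneg a]))
    rw [pi_norm_le_iff_of_nonneg (by positivity)]
    intro k
    have hk := (norm_le_pi_norm _ k).trans h
    have heq : ζ ^ ((k : ℕ) + 1) * (φ ζ - m) k =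
        (g ((2⁻¹ : ℝ) • f (weightedDilation ζ a) + (2⁻¹ : ℝ) • f (weightedDilation ζ b)) -
          ((2⁻¹ : ℝ) • weightedDilation ζ a + (2⁻¹ : ℝ) • weightedDilation ζ b)) k := by
      have h1 : ζ ^ ((k : ℕ) + 1) * φ ζ k = ψ ζ k := congrFun (hφψ ζ hζ0) k
      rw [Pi.sub_apply, mul_sub, h1]
      simp only [hψ, hm, weightedDilation, Pi.sub_apply, Pi.add_apply, Pi.smul_apply,
        Complex.real_smul]
      ring
    rw [← heq, norm_mul, norm_pow] at hk
    -- Here `n < 2 * d` enters: one factor `‖ζ‖` survives division by the weight, which is at most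
    -- `n`.
    have hpow : ‖ζ‖ ^ (2 * d) ≤ ‖ζ‖ ^ ((k : ℕ) + 1) * ‖ζ‖ := by
      rw [← pow_succ]
      exact pow_le_pow_of_le_one hpos.le hζ1.le (by have := k.2; omega)
    refine le_of_mul_le_mul_left (hk.trans ?_) (pow_pos hpos ((k : ℕ) + 1))
    calc C * (‖ζ‖ ^ d * A) ^ 2 = C * A ^ 2 * ‖ζ‖ ^ (2 * d) := by ring
      _ ≤ C * A ^ 2 * (‖ζ‖ ^ ((k : ℕ) + 1) * ‖ζ‖) := by gcongr
      _ = _ := by ring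
  have hφc : ContinuousAt φ 0 := by
    rw [ContinuousAt, hφ0, tendsto_iff_norm_sub_tendsto_zero]
    refine squeeze_zero' (Eventually.of_forall fun _ => norm_nonneg _) hφest ?_
    have : Continuous fun ζ : ℂ => C * A ^ 2 * ‖ζ‖ := by fun_prop
    simpa using this.tendsto 0
  have hφd : DifferentiableOn ℂ φ U := by
    rw [← Complex.differentiableOn_compl_singleton_and_continuousAt_iff (hUo.mem_nhds h0U)]
    refine ⟨?_, hφc⟩
    have : DifferentiableOn ℂ (fun ζ k => ψ ζ k / ζ ^ ((k : ℕ) + 1)) (U \ {0}) := by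
      rw [differentiableOn_pi]
      intro k
      refine ((differentiableOn_pi.1 hψd k).mono sdiff_subset).div (by fun_prop) ?_
      intro ζ hζ
      exact pow_ne_zero _ hζ.2
    refine this.congr fun ζ hζ => ?_
    exact if_neg hζ.2
  have hbound := norm_le_of_monicEval_eq_zero_of_sphere hr0 (inv_pos.2 hr0)
    (hφd.diffContOnCl_ball hrU) (fun ζ hζ T hT => ?_) (mem_closedBall_self hr0.le)
    (t := t) (by rw [hφ0]; exact ht)
  · rw [inv_lt_comm₀ (one_pos.trans hlt) hr0] at hr₁
    linarith
  · have hζr : ‖ζ‖ = r := mem_sphere_zero_iff_norm.1 hζ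
    have hζ0 : ζ ≠ 0 := norm_pos_iff.1 (hζr ▸ hr0)
    have h := monicEval_weightedDilation ζ (φ ζ) T
    rw [hT, mul_zero, hφψ ζ hζ0] at h
    have := (mem_symmetrizedPolydisc_iff _).1 (hψG ζ (hrU (sphere_subset_closedBall hζ))) _ h
    rw [norm_mul, hζr] at this
    rw [← one_div, le_div_iff₀' hr0]
    exact this.le

/-! ### Trinomials violating the midpoint property -/

/-- The coefficient vector of the trinomial `tⁿ + p t + q`. -/
def trinomialCoeff (n : ℕ) (p q : ℂ) : Fin n → ℂ :=
  fun k => if (k : ℕ) + 2 = n then p else if (k : ℕ) + 1 = n then q else 0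

lemma monicEval_trinomialCoeff {n : ℕ} (hn : 2 ≤ n) (p q t : ℂ) :
    monicEval (trinomialCoeff n p q) t = t ^ n + p * t + q := by
  obtain ⟨j, rfl⟩ := Nat.exists_eq_add_of_le' hn
  rw [monicEval, Fin.sum_univ_castSucc, Fin.sum_univ_castSucc, Finset.sum_eq_zero]
  · simp [trinomialCoeff, add_assoc]
  · intro k _
    have := k.2
    simp only [trinomialCoeff, Fin.val_castSucc]
    rw [if_neg (by omega), if_neg (by omega), zero_mul]

/-- From `2tⁿ = t + 1` and `‖t‖ ≥ 1`, the triangle inequality forces `‖t‖ = 1`; its equality case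
then gives `t = 1`. -/
lemma eq_one_of_pow_sub_half_eq_zero {n : ℕ} (hn : 2 ≤ n) {t : ℂ} (ht : 1 ≤ ‖t‖)
    (h : t ^ n + (1 / 2 - 1) * t - 1 / 2 = 0) : t = 1 := by
  have h1 : 2 * t ^ n = t + 1 := by linear_combination 2 * h
  have h2 : 2 * ‖t‖ ^ n = ‖t + 1‖ := by rw [← h1]; simp
  have h3 : ‖t + 1‖ ≤ ‖t‖ + 1 := by simpa using norm_add_le t 1
  have h4 : ‖t‖ ^ 2 ≤ ‖t‖ ^ n := pow_le_pow_right₀ ht hn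
  have h5 : ‖t‖ = 1 := by nlinarith
  rw [h5, one_pow, mul_one] at h2
  have h6 : t.re * t.re + t.im * t.im = 1 := by
    rw [← Complex.normSq_apply, Complex.normSq_eq_norm_sq, h5]; norm_num
  have h7 : (t.re + 1) * (t.re + 1) + t.im * t.im = 4 := by
    have := Complex.normSq_apply (t + 1)
    rw [Complex.normSq_eq_norm_sq, ← h2] at this
    simp at this
    linarith
  have hre : t.re = 1 := by linarith
  have him : t.im = 0 := by rw [hre] at h6; nlinarith
  exact Complex.ext hre him

/-- The trinomial `tⁿ + (c - 1) t - c` has its zeros in the closed disc for some `c` off the real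
line. -/
lemma exists_trinomial_zeros_le_one {n : ℕ} (hn : 2 ≤ n) :
    ∃ ε : ℝ, 0 < ε ∧ ∀ t : ℂ,
      t ^ n + ((1 / 2 + ε * Complex.I) - 1) * t - (1 / 2 + ε * Complex.I) = 0 → ‖t‖ ≤ 1 := by
  have hfac : ∀ c t : ℂ, t ^ n + (c - 1) * t - c =
      (t - 1) * (∑ i ∈ Finset.range n, t ^ i - 1 + c) := by
    intro c t
    have := mul_geom_sum t n
    linear_combination -this
  have hne : ∀ t : ℂ, 1 ≤ ‖t‖ → ∑ i ∈ Finset.range n, t ^ i - 1 + 1 / 2 ≠ 0 := by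
    intro t ht h0
    have := hfac (1 / 2) t
    rw [h0, mul_zero] at this
    rw [eq_one_of_pow_sub_half_eq_zero hn ht this] at h0
    have h1 := congrArg Complex.re h0
    have h2 : (2 : ℝ) ≤ n := by exact_mod_cast hn
    simp at h1
    linarith
  -- At `c = 1/2` the cofactor of `t - 1` is bounded away from zero on `1 ≤ ‖t‖ ≤ 2`, so a small
  -- shift of `c` creates no zero there. Zeros with `‖t‖ > 2` are excluded by size.
  obtain ⟨t₀, ht₀, hmin⟩ := ((isCompact_closedBall (0 : ℂ) 2).diff
    (isOpen_ball (x := (0 : ℂ)) (ε := 1))).exists_isMinOn ⟨1, by simp, by simp⟩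
    (f := fun t : ℂ => ‖∑ i ∈ Finset.range n, t ^ i - 1 + 1 / 2‖) (by fun_prop)
  have hδ : 0 < ‖∑ i ∈ Finset.range n, t₀ ^ i - 1 + 1 / 2‖ :=
    norm_pos_iff.2 (hne t₀ (by simpa using ht₀.2))
  set δ := ‖∑ i ∈ Finset.range n, t₀ ^ i - 1 + 1 / 2‖
  refine ⟨min (δ / 2) (1 / 2), by positivity, fun t ht => ?_⟩
  set ε := min (δ / 2) (1 / 2) with hε
  have hε0 : 0 < ε := by positivity
  have hε1 : ε ≤ 1 / 2 := min_le_right _ _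
  have hεδ : ε < δ := (min_le_left _ _).trans_lt (by linarith)
  have hεn : ‖(ε : ℂ) * Complex.I‖ = ε := by
    rw [norm_mul, Complex.norm_I, mul_one, Complex.norm_real, Real.norm_of_nonneg hε0.le]
  by_contra! hlt
  have hhalf : ‖(1 / 2 : ℂ)‖ = 1 / 2 := by simp
  have ht2 : ‖t‖ ≤ 2 := by
    have h1 : t ^ n = (1 / 2 - ε * Complex.I) * t + (1 / 2 + ε * Complex.I) := by
      linear_combination ht
    have h2 : ‖t‖ ^ n ≤ 1 * ‖t‖ + 1 := by
      rw [← norm_pow, h1]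
      refine (norm_add_le _ _).trans ?_
      rw [norm_mul]
      gcongr
      · refine (norm_sub_le _ _).trans ?_
        rw [hhalf, hεn]; linarith
      · refine (norm_add_le _ _).trans ?_
        rw [hhalf, hεn]; linarith
    have h3 : ‖t‖ ^ 2 ≤ ‖t‖ ^ n := pow_le_pow_right₀ hlt.le hn
    nlinarith
  rw [hfac] at ht
  have ht1 : t - 1 ≠ 0 := by
    rw [sub_ne_zero]; rintro rfl; simp at hlt
  have h0 := (mul_eq_zero.1 ht).resolve_left ht1
  have h1 : ∑ i ∈ Finset.range n, t ^ i - 1 + 1 / 2 = -(ε * Complex.I) := by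
    linear_combination h0
  have h2 : δ ≤ ‖∑ i ∈ Finset.range n, t ^ i - 1 + 1 / 2‖ :=
    hmin ⟨by simpa using ht2, by simpa using hlt.le⟩
  rw [h1, norm_neg, hεn] at h2
  linarith

theorem propositionb (n : ℕ) (hn : 3 ≤ n) : symmetrizedPolydisc n ∉ classE n := by
  intro hE
  have hn2 : 2 ≤ n := by omega
  obtain ⟨ε, hε, hzero⟩ := exists_trinomial_zeros_le_one hn2
  set c : ℂ := 1 / 2 + ε * Complex.I with hc
  set l : ℝ → ℂ := fun α => Complex.exp (α * Complex.I) with hl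
  have hl1 : ∀ α, ‖l α‖ = 1 := fun α => Complex.norm_exp_ofReal_mul_I α
  set p : ℝ → ℂ := fun α => 1 / 2 * (-1 / 2 + l α ^ (n - 1) * (c - 1)) with hp
  set q : ℝ → ℂ := fun α => 1 / 2 * (-1 / 2 - l α ^ n * c) with hq
  have hsupp : ∀ x y : ℂ, ∀ k : Fin n, (k : ℕ) + 1 < n - 1 → trinomialCoeff n x y k = 0 := by
    intro x y k hk
    rw [trinomialCoeff, if_neg (by omega), if_neg (by omega)]
  have hmid : ∀ α t, monicEval (trinomialCoeff n (p α) (q α)) t = 0 → ‖t‖ ≤ 1 := by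
    intro α t ht
    have hcomb : trinomialCoeff n (p α) (q α) = (2⁻¹ : ℝ) • trinomialCoeff n (-1 / 2) (-1 / 2) +
        (2⁻¹ : ℝ) • trinomialCoeff n (l α ^ (n - 1) * (c - 1)) (-(l α ^ n * c)) := by
      funext k
      simp only [trinomialCoeff, Pi.add_apply, Pi.smul_apply, Complex.real_smul]
      split_ifs <;> simp [hp, hq] <;> ring
    rw [hcomb] at ht
    -- `n < 2(n - 1)` is exactly `n ≥ 3`.
    refine norm_le_one_of_monicEval_midpoint_eq_zero (d := n - 1) (by omega) hE (hsupp _ _)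
      (hsupp _ _) (fun s hs => ?_) (fun s hs => ?_) ht
    · rw [monicEval_trinomialCoeff hn2] at hs
      by_contra! hlt
      rw [eq_one_of_pow_sub_half_eq_zero hn2 hlt.le (by linear_combination hs)] at hlt
      simp at hlt
    · rw [monicEval_trinomialCoeff hn2] at hs
      have hl0 : l α ≠ 0 := Complex.exp_ne_zero _
      have h := hzero (s / l α) ?_
      · rwa [norm_div, hl1, div_one] at h
      · have hpow : l α ^ n = l α ^ (n - 1) * l α := by
          rw [← pow_succ]; congr 1; omega
        refine (mul_eq_zero.1 (?_ : l α ^ n * _ = 0)).resolve_left (pow_ne_zero n hl0)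
        rw [← hs, mul_sub, mul_add, div_pow, mul_div_cancel₀ _ (pow_ne_zero n hl0), hpow]
        field_simp
        ring
  -- `u` and `v` are `P'(1)` and `P(1)` for the averaged trinomial.
  set u : ℝ → ℂ := fun α => n + p α with hu
  set v : ℝ → ℂ := fun α => 1 + p α + q α with hv
  have hnonneg : ∀ α, 0 ≤ (u α * starRingEnd ℂ (v α)).re := by
    intro α
    have h := re_deriv_mul_conj_nonneg (hmid α)
    have hfun : monicEval (trinomialCoeff n (p α) (q α)) = fun t => t ^ n + p α * t + q α :=
      funext (monicEval_trinomialCoeff hn2 _ _)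
    have hder : deriv (fun t : ℂ => t ^ n + p α * t + q α) 1 = u α := by
      have : HasDerivAt (fun t : ℂ => t ^ n + p α * t + q α) (n * 1 ^ (n - 1) + p α * 1) 1 :=
        ((hasDerivAt_pow n (1 : ℂ)).add ((hasDerivAt_id (1 : ℂ)).const_mul (p α))).add_const _
      rw [this.deriv]; simp [hu]
    rw [hfun, hder] at h
    simpa [hv] using h
  have hl0 : l 0 = 1 := by simp [hl]
  have hv0 : v 0 = 0 := by simp only [hv, hp, hq, hl0, one_pow]; ring
  have hdl : HasDerivAt l Complex.I 0 := by
    have h1 : HasDerivAt (fun α : ℝ => (α : ℂ) * Complex.I) (1 * Complex.I) 0 :=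
      (Complex.ofRealCLM.hasDerivAt (x := 0)).mul_const _
    simpa using h1.cexp
  have hdlpow : ∀ j : ℕ, HasDerivAt (fun α => l α ^ j) (j * Complex.I) 0 := by
    intro j
    simpa [hl0] using hdl.fun_pow j
  have hdp : HasDerivAt p (1 / 2 * (((n - 1 : ℕ) : ℂ) * Complex.I * (c - 1))) 0 :=
    (((hdlpow (n - 1)).mul_const (c - 1)).const_add (-1 / 2)).const_mul (1 / 2)
  have hdq : HasDerivAt q (1 / 2 * (-(n * Complex.I * c))) 0 :=
    (((hdlpow n).mul_const c).const_sub (-1 / 2)).const_mul (1 / 2)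
  have hnc : ((n - 1 : ℕ) : ℂ) = n - 1 := by push_cast [show 1 ≤ n by omega]; ring
  have hdv : HasDerivAt v (((ε / 2 : ℝ) : ℂ) - ((n / 2 - 1 / 4 : ℝ) : ℂ) * Complex.I) 0 := by
    refine ((hdp.const_add 1).add hdq).congr_deriv ?_
    rw [hnc, hc]
    push_cast
    linear_combination (-(ε : ℂ) / 2) * Complex.I_sq
  have hu0 : u 0 = ((n - 1 / 2 : ℝ) : ℂ) + ((ε / 2 : ℝ) : ℂ) * Complex.I := by
    simp only [hu, hp, hl0, one_pow, hc]
    push_cast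
    ring
  have hd := Complex.reCLM.hasFDerivAt.comp_hasDerivAt (0 : ℝ)
    ((hdp.const_add (n : ℂ)).mul hdv.star)
  have hmin : IsLocalMin (fun α => (u α * starRingEnd ℂ (v α)).re) 0 := by
    refine Eventually.of_forall fun α => ?_
    simpa [hv0] using hnonneg α
  have hcrit := hmin.hasDerivAt_eq_zero hd
  change ((_ * star (v 0) + u 0 * star _ : ℂ)).re = 0 at hcrit
  rw [hv0, star_zero, mul_zero, zero_add, hu0] at hcrit
  simp only [star_sub, star_mul', Complex.star_def, Complex.conj_I, Complex.conj_ofReal,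
    Complex.mul_re, Complex.mul_im, Complex.add_re, Complex.add_im, Complex.sub_re, Complex.sub_im,
    Complex.neg_re, Complex.neg_im, Complex.ofReal_re, Complex.ofReal_im, Complex.I_re,
    Complex.I_im] at hcrit
  have hn3 : (3 : ℝ) ≤ n := by exact_mod_cast hn
  -- The derivative equals `(ε/2)(n/2 - 1/4)`, which is positive.
  nlinarith
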